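/- For complex $s$ let $\Upsilon(s)=\zeta(s)\,\Gamma(s/2)\,\pi^{-s/2}$ and write $\Upsilon_R,\Upsilon_I$ for its real and imaginary parts. For $s=\sigma+it$ and real $v$ let $$M(s,v)=-\frac{(2s-1)\,s}{(2iv-1+s)(2iv-s)}+\frac1{2iv-s},$$ $$T_1(s,v)=-\operatorname{Im}M(s,v)+\operatorname{Im}M(s,-v),\qquad T_2(s,v)=-\operatorname{Re}M(s,v)-\operatorname{Re}M(s,-v)+4 .$$ (These are the kernels in the representation $\operatorname{Re}\xi(s)=\frac1\pi\int_0^\infty\bigl(T_1(s,v)\Upsilon_R(2iv)+T_2(s,v)\Upsilon_I(2iv)\bigr)v\,dv$ for $0<\sigma<1$, where $\xi(s)=(s-1)\pi^{-s/2}\zeta(s)\Gamma(1+s/2)$.) (i) For all real $\sigma$ and $v$, as $t\to\infty$, $$T_j(\sigma+it,v)=\frac{a_j(\sigma,v)}{t^{2}}+\frac{b_j(\sigma,v)}{t^{4}}+\frac{c_j(\sigma,v)}{t^{6}}+O(t^{-8})\qquad(j=1,2),$$ where $$a_1=-12v,\qquad a_2=2-16v^2,$$ $$b_1=4v(9\sigma^2-20v^2-9\sigma+4),\qquad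 b_2=-64v^4+(48\sigma^2-48\sigma+48)v^2-6\sigma^2+6\sigma-2,$$ $$c_1=v\bigl(-448v^4+(800\sigma^2-800\sigma+320)v^2-60\sigma^4+120\sigma^3-160\sigma^2+100\sigma-24\bigr),$$ $$c_2=-256v^6+(640\sigma^2-640\sigma+480)v^4+(-80\sigma^4+160\sigma^3-480\sigma^2+400\sigma-120)v^2+10\sigma^4-20\sigma^3+20\sigma^2-10\sigma+2 .$$ (ii) For every real $\sigma$ the contributions of these terms to the integral for $\operatorname{Re}\xi$ cancel exactly at each of the orders $t^{-2},t^{-4},t^{-6}$: for $(f_1,f_2)=(a_1,a_2),\,(b_1,b_2),\,(c_1,c_2)$, $$\int_0^\infty\bigl(f_1(\sigma,v)\,\Upsilon_R(2iv)+f_2(\sigma,v)\,\Upsilon_I(2iv)\bigr)\,v\,dv=0 .$$ (iii) The corresponding $\sigma$-independent identities hold: $$\int_0^\infty\bigl(-12v^2\,\Upsilon_R(2iv)+v(2-16v^2)\,\Upsilon_I(2iv)\bigr)\,dv=0,$$ $$\int_0^\infty\Bigl(v^4\,\Upsilon_R(2iv)+\frac{v(96v^4-40v^2-1)}{120}\,\Upsilon_I(2iv)\Bigr)\,dv=0,$$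 $$\int_0^\infty\Bigl(224\,v^6\,\Upsilon_R(2iv)-\Bigl(-128v^7+112v^5+\frac{28v^3}{3}+\frac v3\Bigr)\Upsilon_I(2iv)\Bigr)\,dv=0 .$$ All integrals in (ii) and (iii) converge absolutely. -/

import Mathlib

open Set Filter MeasureTheory Asymptotics

noncomputable section

/-- The completed zeta function `Υ(s) = ζ(s) Γ(s/2) π^(-s/2)`. -/
def Upsilon (s : ℂ) : ℂ :=
  riemannZeta s * Complex.Gamma (s / 2) * (Real.pi : ℂ) ^ (-s / 2)

/-- `Υ_R(2iv)`. -/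
def UpsilonR (v : ℝ) : ℝ := (Upsilon (2 * Complex.I * v)).re

/-- `Υ_I(2iv)`. -/
def UpsilonI (v : ℝ) : ℝ := (Upsilon (2 * Complex.I * v)).im

/-- The transfer function `M(s, v)` belonging to the contour `c = -1`. -/
def transferM (s : ℂ) (v : ℝ) : ℂ :=
  -((2 * s - 1) * s / ((2 * Complex.I * v - 1 + s) * (2 * Complex.I * v - s)))
    + 1 / (2 * Complex.I * v - s)

/-- `T₁(s, v) = -M_I(s, v) + M_I(s, -v)`. -/
def T1 (s : ℂ) (v : ℝ) : ℝ := -(transferM s v).im + (transferM s (-v)).im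

/-- `T₂(s, v) = -M_R(s, v) - M_R(s, -v) + 4`. -/
def T2 (s : ℂ) (v : ℝ) : ℝ := -(transferM s v).re - (transferM s (-v)).re + 4

/-- The coefficient of `t⁻²` in the expansion of `T₁(σ + it, v)` as `t → ∞`. -/
def T1coeff2 (_σ v : ℝ) : ℝ := -12 * v

/-- The coefficient of `t⁻⁴` in the expansion of `T₁(σ + it, v)` as `t → ∞`. -/
def T1coeff4 (σ v : ℝ) : ℝ := 4 * v * (9 * σ ^ 2 - 20 * v ^ 2 - 9 * σ + 4)

/-- The coefficient of `t⁻⁶` in the expansion of `T₁(σ + it, v)` as `t → ∞`. -/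
def T1coeff6 (σ v : ℝ) : ℝ :=
  v * (-448 * v ^ 4 + (800 * σ ^ 2 - 800 * σ + 320) * v ^ 2
    - 60 * σ ^ 4 + 120 * σ ^ 3 - 160 * σ ^ 2 + 100 * σ - 24)

/-- The coefficient of `t⁻²` in the expansion of `T₂(σ + it, v)` as `t → ∞`. -/
def T2coeff2 (_σ v : ℝ) : ℝ := -16 * v ^ 2 + 2

/-- The coefficient of `t⁻⁴` in the expansion of `T₂(σ + it, v)` as `t → ∞`. -/
def T2coeff4 (σ v : ℝ) : ℝ :=
  -64 * v ^ 4 + (48 * σ ^ 2 - 48 * σ + 48) * v ^ 2 - 6 * σ ^ 2 + 6 * σ - 2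

/-- The coefficient of `t⁻⁶` in the expansion of `T₂(σ + it, v)` as `t → ∞`. -/
def T2coeff6 (σ v : ℝ) : ℝ :=
  -256 * v ^ 6 + (640 * σ ^ 2 - 640 * σ + 480) * v ^ 4
    + (-80 * σ ^ 4 + 160 * σ ^ 3 - 480 * σ ^ 2 + 400 * σ - 120) * v ^ 2
    + 10 * σ ^ 4 - 20 * σ ^ 3 + 20 * σ ^ 2 - 10 * σ + 2

/-- The contribution `(a Υ_R(2iv) + b Υ_I(2iv)) v` to the integrand of `ξ_R` that arises from
terms `a(v)` of `T₁` and `b(v)` of `T₂`. -/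
def xiIntegrand (a b : ℝ → ℝ) (v : ℝ) : ℝ := (a v * UpsilonR v + b v * UpsilonI v) * v

/-- The integral of `f` over `(0, ∞)` converges absolutely and its value is `0`. -/
def IntegralVanishes (f : ℝ → ℝ) : Prop :=
  IntegrableOn f (Ioi 0) ∧ ∫ v in Ioi (0 : ℝ), f v = 0

end

/-! For v > 0, Υ(2iv) is Λ(2iv), and s(s-1)Λ(s) extends to an entire function symmetric under s ↦
1-s. Multiplied by (2s-1)(s(s-1))ᵏ it becomes odd. It decays exponentially in 0 ≤ Re s ≤ 1, so
Cauchy's theorem equates its integrals over Re s = 0 and Re s = 1, while oddness makes them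
opposite: both vanish. Real parts on s = 2iv give one linear relation per k
(`integralVanishes_xiMoment`). All the vanishing integrals are combinations of k = 0, 1, 2. The
decay (`exists_norm_entireXi_le`) comes from Γ on Re s = 2, the functional equation on Re s = -1,
and Phragmén–Lindelöf in between. The expansions in t are geometric series applied to the partial
fractions of M (`transferM_eq`). -/

/-! ### Symmetries and strip bounds of the completed zeta function. -/

section CompletedZeta

open Complex HurwitzZeta ComplexConjugate

/-- The entire function `s (s - 1) Λ(s)`, where `Λ` is the completed Riemann zeta function. -/
noncomputable def entireXi (s : ℂ) : ℂ := s * (s - 1) * completedRiemannZeta₀ s + 1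

theorem differentiable_entireXi : Differentiable ℂ entireXi := by
  have := differentiable_completedZeta₀
  unfold entireXi
  fun_prop

theorem entireXi_one_sub (s : ℂ) : entireXi (1 - s) = entireXi s := by
  unfold entireXi
  rw [completedRiemannZeta₀_one_sub]
  ring

theorem entireXi_eq {s : ℂ} (h0 : s ≠ 0) (h1 : s ≠ 1) :
    entireXi s = s * (s - 1) * completedRiemannZeta s := by
  have h1' : 1 - s ≠ 0 := sub_ne_zero.mpr h1.symm
  rw [completedRiemannZeta_eq, entireXi]
  field_simp
  ring

theorem mellinConvergent_hurwitzEvenFEPair_f_modif (s : ℂ) :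
    MellinConvergent (hurwitzEvenFEPair 0).f_modif s :=
  ((hurwitzEvenFEPair 0).isStrongFEPair_toStrongFEPair.hasMellin s).1

/-- Λ₀ is half the Mellin transform, at s/2, of a real-valued function. -/
theorem completedRiemannZeta₀_conj (s : ℂ) :
    completedRiemannZeta₀ (conj s) = conj (completedRiemannZeta₀ s) := by
  have hf : ∀ x, conj ((hurwitzEvenFEPair 0).f_modif x) = (hurwitzEvenFEPair 0).f_modif x := by
    intro x
    simp only [WeakFEPair.f_modif, hurwitzEvenFEPair, Pi.add_apply, map_add, indicator]
    split_ifs <;> simp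
  simp only [completedRiemannZeta₀, completedHurwitzZetaEven₀, WeakFEPair.Λ₀, mellin, map_div₀,
    map_ofNat]
  rw [← integral_conj]
  congr 1
  refine setIntegral_congr_fun measurableSet_Ioi fun x (hx : 0 < x) ↦ ?_
  simp only [smul_eq_mul, map_mul, hf]
  congr 1
  have h := cpow_conj (x : ℂ) (s / 2 - 1) ?_
  · simpa [conj_ofReal, map_ofNat] using h
  · rw [arg_ofReal_of_nonneg hx.le]
    exact Real.pi_pos.ne

theorem entireXi_conj (s : ℂ) : entireXi (conj s) = conj (entireXi s) := by
  simp [entireXi, completedRiemannZeta₀_conj]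

/-- Between the edges of the strip, the modulus of the Mellin kernel is at most the sum of its
values at the two edges. This supplies the a priori growth bound for Phragmén–Lindelöf. -/
theorem exists_norm_completedRiemannZeta₀_le (a b : ℝ) :
    ∃ C, ∀ s : ℂ, a ≤ s.re → s.re ≤ b → ‖completedRiemannZeta₀ s‖ ≤ C := by
  set f := (hurwitzEvenFEPair 0).f_modif with hf
  have hint : ∀ r : ℝ, IntegrableOn (fun x : ℝ ↦ x ^ (r / 2 - 1) * ‖f x‖) (Ioi 0) := by
    intro r
    have := (mellinConvergent_hurwitzEvenFEPair_f_modif ((r / 2 : ℝ) : ℂ)).norm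
    refine IntegrableOn.congr_fun this (fun x (hx : 0 < x) ↦ ?_) measurableSet_Ioi
    simp only [norm_smul, norm_cpow_eq_rpow_re_of_pos hx, sub_re, ofReal_re, one_re, hf]
  refine ⟨(∫ x in Ioi (0 : ℝ), (x ^ (a / 2 - 1) * ‖f x‖ + x ^ (b / 2 - 1) * ‖f x‖)) / 2,
    fun s ha hb ↦ ?_⟩
  have key : ‖mellin f (s / 2)‖
      ≤ ∫ x in Ioi (0 : ℝ), (x ^ (a / 2 - 1) * ‖f x‖ + x ^ (b / 2 - 1) * ‖f x‖) := by
    refine norm_integral_le_of_norm_le ((hint a).add (hint b)) ?_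
    refine (ae_restrict_iff' measurableSet_Ioi).mpr (ae_of_all _ fun x (hx : 0 < x) ↦ ?_)
    have hre : (s / 2 - 1).re = s.re / 2 - 1 := by simp
    rw [norm_smul, norm_cpow_eq_rpow_re_of_pos hx, hre, ← add_mul]
    refine mul_le_mul_of_nonneg_right ?_ (norm_nonneg _)
    rcases le_total x 1 with h | h
    · exact (Real.rpow_le_rpow_of_exponent_ge hx h (by linarith)).trans
        (le_add_of_nonneg_right (Real.rpow_nonneg hx.le _))
    · exact (Real.rpow_le_rpow_of_exponent_le h (by linarith)).trans
        (le_add_of_nonneg_left (Real.rpow_nonneg hx.le _))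
  rw [completedRiemannZeta₀, completedHurwitzZetaEven₀, WeakFEPair.Λ₀, ← hf, norm_div, norm_ofNat]
  gcongr

end CompletedZeta

/-! ### Exponential decay on the line Re s = 2. -/

section Gamma

open Complex ComplexConjugate

/-- Reflection formula at z = iy combined with Γ(1+iy) = iy Γ(iy). At y = 0 the right side would be
0/0 = 0. -/
theorem norm_Gamma_one_add_mul_I_sq (y : ℝ) (hy : y ≠ 0) :
    ‖Gamma (1 + y * I)‖ ^ 2 = Real.pi * y / Real.sinh (Real.pi * y) := by
  have hyI : (y : ℂ) * I ≠ 0 := by simp [hy]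
  have h1 : conj (Gamma (1 + y * I)) = Gamma (1 - y * I) := by
    rw [← Gamma_conj]
    simp [sub_eq_add_neg]
  have h2 : Gamma (1 + y * I) * Gamma (1 - y * I)
      = ((Real.pi * y / Real.sinh (Real.pi * y) : ℝ) : ℂ) := by
    rw [add_comm, Gamma_add_one _ hyI, mul_assoc, Gamma_mul_Gamma_one_sub,
      show (Real.pi : ℂ) * (y * I) = (Real.pi * y : ℂ) * I by ring, sin_mul_I]
    push_cast
    field_simp
  have h3 := mul_conj' (Gamma (1 + y * I))
  rw [h1, h2] at h3
  exact_mod_cast h3.symm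

theorem div_sinh_le (x : ℝ) (hx : x ≠ 0) : x / Real.sinh x ≤ 2 * Real.exp (-|x| / 2) := by
  have hpos : ∀ x : ℝ, 0 < x → x / Real.sinh x ≤ 2 * Real.exp (-x / 2) := by
    intro x hx
    have h1 : Real.sinh x = 2 * Real.sinh (x / 2) * Real.cosh (x / 2) := by
      rw [← Real.sinh_two_mul]
      ring_nf
    have h2 : x / 2 ≤ Real.sinh (x / 2) := Real.self_le_sinh_iff.mpr (by linarith)
    have h3 : Real.exp (x / 2) / 2 ≤ Real.cosh (x / 2) := by
      rw [Real.cosh_eq]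
      linarith [Real.exp_pos (-(x / 2))]
    have h4 : Real.exp (-x / 2) * Real.exp (x / 2) = 1 := by
      rw [← Real.exp_add]
      ring_nf
      simp
    rw [div_le_iff₀ (Real.sinh_pos_iff.mpr hx), h1]
    calc x = 2 * Real.exp (-x / 2) * (2 * (x / 2) * (Real.exp (x / 2) / 2)) := by
          linear_combination (-x) * h4
      _ ≤ _ := by gcongr
  rcases lt_or_gt_of_ne hx with h | h
  · have := hpos (-x) (by linarith)
    rwa [Real.sinh_neg, neg_div_neg_eq, ← abs_of_neg h] at this
  · simpa [abs_of_pos h] using hpos x h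

theorem norm_Gamma_one_add_mul_I_le (y : ℝ) :
    ‖Gamma (1 + y * I)‖ ≤ 2 * Real.exp (-Real.pi * |y| / 4) := by
  rcases eq_or_ne y 0 with rfl | hy
  · simp
  refine (sq_le_sq₀ (norm_nonneg _) (by positivity)).mp ?_
  have hpy : Real.pi * y ≠ 0 := mul_ne_zero Real.pi_ne_zero hy
  rw [norm_Gamma_one_add_mul_I_sq y hy, mul_pow, ← Real.exp_nat_mul]
  refine (div_sinh_le _ hpy).trans ?_
  rw [abs_mul, abs_of_pos Real.pi_pos]
  have : ((2 : ℕ) : ℝ) * (-Real.pi * |y| / 4) = -(Real.pi * |y|) / 2 := by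
    push_cast
    ring
  rw [this]
  linarith [Real.exp_pos (-(Real.pi * |y|) / 2)]

theorem exists_norm_completedRiemannZeta_le_of_re_eq_two :
    ∃ C, 0 < C ∧ ∀ s : ℂ, s.re = 2 →
      ‖completedRiemannZeta s‖ ≤ C * Real.exp (-(3 / 8) * |s.im|) := by
  refine ⟨2 * (1 + ∑' n : ℕ, ‖1 / (n : ℂ) ^ (2 : ℂ)‖), by positivity, fun s hs ↦ ?_⟩
  have hs1 : 1 < s.re := by rw [hs]; norm_num
  have hsum : Summable fun n : ℕ ↦ ‖1 / (n : ℂ) ^ (2 : ℂ)‖ :=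
    (summable_one_div_nat_cpow.mpr (by norm_num)).norm
  have hterm : ∀ n : ℕ, ‖1 / (n : ℂ) ^ s‖ = ‖1 / (n : ℂ) ^ (2 : ℂ)‖ := by
    intro n
    rcases Nat.eq_zero_or_pos n with rfl | hn
    · simp [zero_cpow (ne_zero_of_one_lt_re hs1)]
    · simp only [norm_div, norm_natCast_cpow_of_pos hn, hs, re_ofNat]
  have hz : ‖∑' n : ℕ, 1 / (n : ℂ) ^ s‖ ≤ 1 + ∑' n : ℕ, ‖1 / (n : ℂ) ^ (2 : ℂ)‖ := by
    refine (norm_tsum_le_tsum_norm (by simpa only [hterm] using hsum)).trans ?_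
    simp only [hterm]
    linarith
  have hpi : ‖(Real.pi : ℂ) ^ (-s / 2)‖ ≤ 1 := by
    rw [norm_cpow_eq_rpow_re_of_pos Real.pi_pos]
    refine Real.rpow_le_one_of_one_le_of_nonpos (by linarith [Real.pi_gt_three]) ?_
    simp [hs]
  have hG : ‖Gamma (s / 2)‖ ≤ 2 * Real.exp (-(3 / 8) * |s.im|) := by
    have h2 : s / 2 = 1 + ((s.im / 2 : ℝ) : ℂ) * I := by
      apply Complex.ext <;> simp [hs]
    rw [h2]
    refine (norm_Gamma_one_add_mul_I_le _).trans ?_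
    -- The rate is π/8, weakened to 3/8 by π > 3.
    have : -Real.pi * |s.im / 2| / 4 ≤ -(3 / 8) * |s.im| := by
      rw [abs_div, abs_two]
      nlinarith [Real.pi_gt_three, abs_nonneg s.im]
    gcongr
  rw [completedZeta_eq_tsum_of_one_lt_re hs1, norm_mul, norm_mul]
  calc _ ≤ 1 * (2 * Real.exp (-(3 / 8) * |s.im|)) * (1 + ∑' n : ℕ, ‖1 / (n : ℂ) ^ (2 : ℂ)‖) := by
        gcongr
    _ = _ := by ring

end Gamma

/-! ### Exponential decay throughout -1 ≤ Re s ≤ 2. -/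

section Decay

open Complex

theorem exists_add_pow_le_exp (n : ℕ) {a : ℝ} (ha : 0 < a) :
    ∃ C, 0 < C ∧ ∀ x : ℝ, 0 ≤ x → (3 + x) ^ n ≤ C * Real.exp (a * x) := by
  refine ⟨n.factorial * Real.exp (3 * a) / a ^ n, by positivity, fun x hx ↦ ?_⟩
  have h := Real.pow_div_factorial_le_exp (x := a * (3 + x)) (by positivity) n
  rw [div_le_iff₀ (by positivity), mul_pow, mul_add, Real.exp_add] at h
  rw [div_mul_eq_mul_div, le_div_iff₀ (by positivity), mul_comm a 3] at *
  linarith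

theorem norm_le_of_re_mem_Icc {s : ℂ} (h1 : -1 ≤ s.re) (h2 : s.re ≤ 2) :
    ‖s‖ ≤ 3 + |s.im| := by
  have := norm_le_abs_re_add_abs_im s
  have : |s.re| ≤ 2 := abs_le.mpr ⟨by linarith, h2⟩
  linarith

theorem norm_mul_sub_one_le {s : ℂ} (h1 : -1 ≤ s.re) (h2 : s.re ≤ 2) :
    ‖s * (s - 1)‖ ≤ (3 + |s.im|) ^ 2 := by
  have h : ‖1 - s‖ ≤ 3 + |s.im| := by
    have := norm_le_of_re_mem_Icc (s := 1 - s) (by simp; linarith) (by simp; linarith)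
    simpa using this
  rw [norm_mul, norm_sub_rev, sq]
  exact mul_le_mul (norm_le_of_re_mem_Icc h1 h2) h (norm_nonneg _) (by positivity)

theorem exists_norm_entireXi_le_of_re_eq_two :
    ∃ C, 0 < C ∧ ∀ s : ℂ, s.re = 2 → ‖entireXi s‖ ≤ C * Real.exp (-(1 / 4) * |s.im|) := by
  obtain ⟨A, hA, hA'⟩ := exists_norm_completedRiemannZeta_le_of_re_eq_two
  obtain ⟨B, hB, hB'⟩ := exists_add_pow_le_exp 2 (a := 1 / 8) (by norm_num)
  refine ⟨B * A, by positivity, fun s hs ↦ ?_⟩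
  have h0 : s ≠ 0 := by rintro rfl; norm_num at hs
  have h1 : s ≠ 1 := by rintro rfl; norm_num at hs
  rw [entireXi_eq h0 h1, norm_mul]
  calc _ ≤ B * Real.exp (1 / 8 * |s.im|) * (A * Real.exp (-(3 / 8) * |s.im|)) := by
        gcongr
        · exact (norm_mul_sub_one_le (by linarith) (by linarith)).trans (hB' _ (abs_nonneg _))
        · exact hA' s hs
    _ = B * A * (Real.exp (1 / 8 * |s.im|) * Real.exp (-(3 / 8) * |s.im|)) := by ring
    _ = _ := by
        rw [← Real.exp_add]
        ring_nf

theorem exists_norm_entireXi_le_of_re_eq_neg_one :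
    ∃ C, 0 < C ∧ ∀ s : ℂ, s.re = -1 → ‖entireXi s‖ ≤ C * Real.exp (-(1 / 4) * |s.im|) := by
  obtain ⟨C, hC, h⟩ := exists_norm_entireXi_le_of_re_eq_two
  refine ⟨C, hC, fun s hs ↦ ?_⟩
  have := h (1 - s) (by simp [hs]; norm_num)
  simpa [entireXi_one_sub] using this

theorem norm_cexp_neg_mul_I_mul (a : ℝ) (s : ℂ) :
    ‖cexp (-(a * I) * s)‖ = Real.exp (a * s.im) := by
  rw [norm_exp]
  simp

/-- The function `s (s - 1) Λ(s)` decays exponentially along vertical lines. -/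
theorem exists_norm_entireXi_le :
    ∃ C, 0 < C ∧ ∀ s : ℂ, -1 ≤ s.re → s.re ≤ 2 →
      ‖entireXi s‖ ≤ C * Real.exp (-(1 / 4) * |s.im|) := by
  obtain ⟨C₁, hC₁, h₁⟩ := exists_norm_entireXi_le_of_re_eq_neg_one
  obtain ⟨C₂, hC₂, h₂⟩ := exists_norm_entireXi_le_of_re_eq_two
  obtain ⟨B, hB⟩ := exists_norm_completedRiemannZeta₀_le (-1) 2
  obtain ⟨D, hD, hD'⟩ := exists_add_pow_le_exp 2 (a := 1 / 4) (by norm_num)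
  -- The twist has modulus exp(a Im s), so on both edges it at most cancels the decay. Taking a of
  -- the same sign as Im s recovers the decay in each half of the strip.
  have main : ∀ a : ℝ, |a| = 1 / 4 → ∀ s : ℂ, -1 ≤ s.re → s.re ≤ 2 →
      ‖entireXi s * cexp (-(a * I) * s)‖ ≤ C₁ + C₂ := by
    intro a ha s hs1 hs2
    have hexp : ∀ z : ℂ, ‖cexp (-(a * I) * z)‖ ≤ Real.exp (1 / 4 * |z.im|) := by
      intro z
      rw [norm_cexp_neg_mul_I_mul, ← ha, ← abs_mul]
      exact Real.exp_le_exp.mpr (le_abs_self _)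
    have hbd : ∀ (C : ℝ) (z : ℂ), ‖entireXi z‖ ≤ C * Real.exp (-(1 / 4) * |z.im|) →
        ‖entireXi z * cexp (-(a * I) * z)‖ ≤ C := by
      intro C z hz
      rw [norm_mul]
      calc _ ≤ C * Real.exp (-(1 / 4) * |z.im|) * Real.exp (1 / 4 * |z.im|) :=
            mul_le_mul hz (hexp z) (norm_nonneg _) ((norm_nonneg _).trans hz)
        _ = C := by
            rw [mul_assoc, ← Real.exp_add]
            ring_nf
            simp
    refine PhragmenLindelof.vertical_strip (f := fun s ↦ entireXi s * cexp (-(a * I) * s))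
      (a := -1) (b := 2) ?_ ?_ ?_ ?_ hs1 hs2
    · exact (differentiable_entireXi.mul (by fun_prop)).diffContOnCl
    -- A strip of width 3 allows growth exp(B exp(c|Im z|)) with c < π/3; c = 1 qualifies.
    · refine ⟨1, ?_, 1, IsBigO.of_bound (D * |B| + 1) ?_⟩
      · rw [lt_div_iff₀ (by norm_num)]
        linarith [Real.pi_gt_three]
      · refine Eventually.filter_mono inf_le_right (eventually_principal.mpr fun z hz ↦ ?_)
        have hz1 : -1 ≤ z.re := hz.1.le
        have hz2 : z.re ≤ 2 := hz.2.le
        have hone : 1 ≤ Real.exp (1 / 4 * |z.im|) := Real.one_le_exp (by positivity)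
        have hxi : ‖entireXi z‖ ≤ (D * |B| + 1) * Real.exp (1 / 4 * |z.im|) := by
          calc _ ≤ ‖z * (z - 1)‖ * ‖completedRiemannZeta₀ z‖ + 1 := by
                refine (norm_add_le _ _).trans ?_
                rw [norm_mul, norm_one]
            _ ≤ D * Real.exp (1 / 4 * |z.im|) * |B| + 1 * Real.exp (1 / 4 * |z.im|) := by
                gcongr
                · exact (norm_mul_sub_one_le hz1 hz2).trans (hD' _ (abs_nonneg _))
                · exact (hB z hz1 hz2).trans (le_abs_self B)
                · linarith
            _ = _ := by ring
        rw [norm_mul, Real.norm_of_nonneg (Real.exp_pos _).le, one_mul, one_mul]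
        calc _ ≤ (D * |B| + 1) * Real.exp (1 / 4 * |z.im|) * Real.exp (1 / 4 * |z.im|) := by
              gcongr
              exact hexp z
          _ = (D * |B| + 1) * Real.exp (1 / 2 * |z.im|) := by
              rw [mul_assoc, ← Real.exp_add]
              ring_nf
          _ ≤ _ := by
              gcongr
              linarith [Real.add_one_le_exp |z.im|, abs_nonneg z.im]
    · exact fun z hz ↦ (hbd C₁ z (h₁ z hz)).trans (by linarith)
    · exact fun z hz ↦ (hbd C₂ z (h₂ z hz)).trans (by linarith)
  have main' : ∀ a : ℝ, |a| = 1 / 4 → ∀ s : ℂ, -1 ≤ s.re → s.re ≤ 2 →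
      ‖entireXi s‖ ≤ (C₁ + C₂) * Real.exp (-(a * s.im)) := by
    intro a ha s hs1 hs2
    have := main a ha s hs1 hs2
    rw [norm_mul, norm_cexp_neg_mul_I_mul] at this
    rwa [Real.exp_neg, ← div_eq_mul_inv, le_div_iff₀ (Real.exp_pos _)]
  refine ⟨C₁ + C₂, by positivity, fun s hs1 hs2 ↦ ?_⟩
  rcases le_total 0 s.im with h | h
  · have := main' (1 / 4) (by norm_num) s hs1 hs2
    rwa [abs_of_nonneg h, neg_mul]
  · have := main' (-(1 / 4)) (by norm_num) s hs1 hs2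
    rw [abs_of_nonpos h]
    convert this using 3
    ring

end Decay

/-! ### Vanishing integrals of odd functions along the imaginary axis. -/

section VerticalIntegral

open Complex ComplexConjugate

theorem integrable_exp_neg_mul_abs {a : ℝ} (ha : 0 < a) :
    Integrable fun t : ℝ ↦ Real.exp (-a * |t|) := by
  have h : IntegrableOn (fun t : ℝ ↦ Real.exp (-a * |t|)) (Ioi 0) := by
    refine (exp_neg_integrableOn_Ioi 0 ha).congr_fun (fun t (ht : 0 < t) ↦ ?_) measurableSet_Ioi
    simp only [abs_of_pos ht]
  have h' : IntegrableOn (fun t : ℝ ↦ Real.exp (-a * |t|)) (Iic 0) := by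
    refine (integrableOn_exp_mul_Iic ha 0).congr_fun (fun t (ht : t ≤ 0) ↦ ?_) measurableSet_Iic
    simp only [abs_of_nonpos ht, neg_mul_neg]
  rw [← integrableOn_univ, ← Iic_union_Ioi (a := (0 : ℝ))]
  exact h'.union h

variable {g : ℂ → ℂ} {C a : ℝ}

theorem integrable_vertical_of_exp_decay (hg : Differentiable ℂ g) (ha : 0 < a)
    (hb : ∀ s : ℂ, 0 ≤ s.re → s.re ≤ 1 → ‖g s‖ ≤ C * Real.exp (-a * |s.im|))
    {c : ℝ} (h0 : 0 ≤ c) (h1 : c ≤ 1) : Integrable fun t : ℝ ↦ g (c + t * I) := by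
  refine ((integrable_exp_neg_mul_abs ha).const_mul C).mono' ?_ (ae_of_all _ fun t ↦ ?_)
  · exact (hg.continuous.comp (by fun_prop)).aestronglyMeasurable
  · have := hb (c + t * I) (by simpa) (by simpa)
    simpa using this

/-- Cauchy on the rectangle [0,1] × [-T,T]; the horizontal sides vanish as T → ∞. -/
theorem integral_vertical_eq_of_exp_decay (hg : Differentiable ℂ g) (ha : 0 < a)
    (hb : ∀ s : ℂ, 0 ≤ s.re → s.re ≤ 1 → ‖g s‖ ≤ C * Real.exp (-a * |s.im|)) :
    ∫ t : ℝ, g (t * I) = ∫ t : ℝ, g (1 + t * I) := by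
  have i0 : Integrable fun t : ℝ ↦ g (t * I) := by
    simpa using integrable_vertical_of_exp_decay hg ha hb le_rfl zero_le_one
  have i1 : Integrable fun t : ℝ ↦ g (1 + t * I) := by
    simpa using integrable_vertical_of_exp_decay hg ha hb zero_le_one le_rfl
  have l0 := intervalIntegral_tendsto_integral i0 tendsto_neg_atTop_atBot tendsto_id
  have l1 := intervalIntegral_tendsto_integral i1 tendsto_neg_atTop_atBot tendsto_id
  have hrect : ∀ T : ℝ, ‖(∫ t in (-T)..T, g (1 + t * I)) - ∫ t in (-T)..T, g (t * I)‖
      ≤ 2 * (C * Real.exp (-a * |T|)) := by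
    intro T
    have h := integral_boundary_rect_eq_zero_of_differentiableOn g ⟨0, -T⟩ ⟨1, T⟩
      hg.differentiableOn
    simp only [ofReal_zero, zero_add, ofReal_one] at h
    have hside : ∀ y : ℝ, |y| = |T| →
        ‖∫ x : ℝ in (0 : ℝ)..1, g (x + y * I)‖ ≤ C * Real.exp (-a * |T|) := by
      intro y hy
      have := intervalIntegral.norm_integral_le_of_norm_le_const (a := 0) (b := 1)
        (f := fun x : ℝ ↦ g (x + y * I)) (C := C * Real.exp (-a * |T|)) fun x hx ↦ by
          rw [uIoc_of_le zero_le_one] at hx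
          have := hb (x + y * I) (by simpa using hx.1.le) (by simpa using hx.2)
          simpa [hy] using this
      simpa using this
    have e : (∫ t in (-T)..T, g (1 + t * I)) - ∫ t in (-T)..T, g (t * I)
        = I * ((∫ x : ℝ in (0 : ℝ)..1, g (x + (-T : ℝ) * I))
          - ∫ x : ℝ in (0 : ℝ)..1, g (x + T * I)) := by
      simp only [smul_eq_mul] at h
      linear_combination (-I) * h
        + ((∫ t in (-T)..T, g (1 + t * I)) - ∫ t in (-T)..T, g (t * I)) * I_sq
    rw [e, norm_mul, norm_I, one_mul, two_mul]
    exact (norm_sub_le _ _).trans (add_le_add (hside _ (abs_neg T)) (hside _ rfl))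
  have hlim : Tendsto (fun T : ℝ ↦ 2 * (C * Real.exp (-a * |T|))) atTop (nhds 0) := by
    have : Tendsto (fun T : ℝ ↦ Real.exp (-a * |T|)) atTop (nhds 0) :=
      Real.tendsto_exp_atBot.comp
        (tendsto_abs_atTop_atTop.const_mul_atTop_of_neg (neg_lt_zero.mpr ha))
    simpa using (this.const_mul C).const_mul 2
  have := squeeze_zero_norm hrect hlim
  exact (sub_eq_zero.mp (tendsto_nhds_unique (l1.sub l0) this)).symm

theorem integral_vertical_eq_zero_of_odd (hg : Differentiable ℂ g) (ha : 0 < a)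
    (hb : ∀ s : ℂ, 0 ≤ s.re → s.re ≤ 1 → ‖g s‖ ≤ C * Real.exp (-a * |s.im|))
    (hodd : ∀ s, g (1 - s) = -g s) : ∫ t : ℝ, g (t * I) = 0 := by
  have h := integral_vertical_eq_of_exp_decay hg ha hb
  have h2 : ∫ t : ℝ, g (1 + t * I) = -∫ t : ℝ, g (t * I) := by
    rw [← integral_neg_eq_self, ← integral_neg]
    congr 1 with t
    rw [← hodd]
    congr 1
    push_cast
    ring
  rw [h2] at h
  exact self_eq_neg.mp h

theorem integralVanishes_re_of_odd (hg : Differentiable ℂ g) (ha : 0 < a)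
    (hb : ∀ s : ℂ, 0 ≤ s.re → s.re ≤ 1 → ‖g s‖ ≤ C * Real.exp (-a * |s.im|))
    (hodd : ∀ s, g (1 - s) = -g s) (hconj : ∀ s, g (conj s) = conj (g s)) :
    IntegralVanishes fun v ↦ (g (2 * I * v)).re := by
  have i0 : Integrable fun t : ℝ ↦ g (t * I) := by
    simpa using integrable_vertical_of_exp_decay hg ha hb le_rfl zero_le_one
  have ire : Integrable fun t : ℝ ↦ (g (t * I)).re := i0.re
  have hz : ∫ t : ℝ, (g (t * I)).re = 0 := by
    have := integral_re i0
    rw [integral_vertical_eq_zero_of_odd hg ha hb hodd] at this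
    simpa using this
  -- Conjugation symmetry makes the real part even, so its half-line integral is half of zero.
  have heven : ∀ t : ℝ, (g ((-t : ℝ) * I)).re = (g (t * I)).re := by
    intro t
    rw [← conj_re (g (t * I)), ← hconj]
    simp
  have habs : ∀ t : ℝ, (g ((|t| : ℝ) * I)).re = (g (t * I)).re := by
    intro t
    rcases abs_choice t with h | h
    · rw [h]
    · rw [h, heven]
  have hhalf : ∫ t in Ioi (0 : ℝ), (g (t * I)).re = 0 := by
    have := integral_comp_abs (f := fun t : ℝ ↦ (g (t * I)).re)
    simp only [habs, hz] at this
    linarith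
  have hrw : (fun v : ℝ ↦ (g (2 * I * v)).re) = fun v : ℝ ↦ (g ((2 * v : ℝ) * I)).re := by
    ext v
    push_cast
    ring_nf
  rw [IntegralVanishes, hrw]
  refine ⟨(ire.comp_mul_left' two_ne_zero).integrableOn, ?_⟩
  have := integral_comp_mul_left_Ioi (fun t : ℝ ↦ (g (t * I)).re) 0 two_pos
  simpa [hhalf] using this

end VerticalIntegral

/-! ### Expansions of the kernels as t → ∞. -/

section Expansion

open Complex

theorem one_div_sub_eq_geom (τ t : ℂ) (ht : t ≠ 0) (h : t - τ ≠ 0) (n : ℕ) :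
    1 / (t - τ) = ∑ k ∈ Finset.range n, τ ^ k / t ^ (k + 1) + τ ^ n / (t ^ n * (t - τ)) := by
  induction n with
  | zero => simp
  | succ n ih =>
    rw [Finset.sum_range_succ, ih, add_assoc]
    congr 1
    field_simp
    ring

theorem isBigO_one_div_sub_geom (τ : ℂ) (n : ℕ) :
    (fun t : ℝ ↦ 1 / ((t : ℂ) - τ) - ∑ k ∈ Finset.range n, τ ^ k / (t : ℂ) ^ (k + 1))
      =O[atTop] (fun t : ℝ ↦ 1 / t ^ (n + 1)) := by
  refine IsBigO.of_bound (2 * ‖τ‖ ^ n) ?_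
  filter_upwards [eventually_ge_atTop (2 * ‖τ‖ + 1)] with t ht
  have ht0 : 0 < t := by linarith [norm_nonneg τ]
  have hlow : t / 2 ≤ ‖(t : ℂ) - τ‖ := by
    have := norm_sub_norm_le (t : ℂ) τ
    rw [norm_real, Real.norm_of_nonneg ht0.le] at this
    linarith
  have hne : (t : ℂ) - τ ≠ 0 := norm_pos_iff.mp (by linarith)
  rw [one_div_sub_eq_geom τ t (by exact_mod_cast ht0.ne') hne n, add_sub_cancel_left, norm_div,
    norm_mul, norm_pow, norm_pow, norm_real, Real.norm_of_nonneg ht0.le,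
    Real.norm_of_nonneg (by positivity), div_le_iff₀ (by positivity)]
  calc ‖τ‖ ^ n = 2 * ‖τ‖ ^ n * (1 / t ^ (n + 1)) * (t ^ n * (t / 2)) := by
        field_simp
        ring
    _ ≤ _ := by gcongr

theorem isBigO_re {f : ℝ → ℂ} {g : ℝ → ℝ} {l : Filter ℝ} (h : f =O[l] g) :
    (fun t ↦ (f t).re) =O[l] g :=
  (IsBigO.of_norm_le fun t ↦ abs_re_le_norm (f t)).trans h.norm_left

theorem isBigO_im {f : ℝ → ℂ} {g : ℝ → ℝ} {l : Filter ℝ} (h : f =O[l] g) :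
    (fun t ↦ (f t).im) =O[l] g :=
  (IsBigO.of_norm_le fun t ↦ abs_im_le_norm (f t)).trans h.norm_left

/-- The coefficient of `t ^ (-(k + 1))` in the expansion of `transferM (σ + i t) v`. -/
noncomputable def transferMCoeff (σ v : ℝ) (k : ℕ) : ℂ :=
  I * (1 - 2 * I * v) * ((2 * v + σ * I) ^ k - (-2 * v + (σ - 1) * I) ^ k)

/-- With w = 2iv, partial fractions give M = 2 + (1-w)(1/(w-s) + 1/(w-1+s)). The two constants 2 are
what the +4 in `T2` removes. -/
theorem transferM_eq (σ v t : ℝ) (h1 : (t : ℂ) - (2 * v + σ * I) ≠ 0)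
    (h2 : (t : ℂ) - (-2 * v + (σ - 1) * I) ≠ 0) :
    transferM (σ + t * I) v = 2 + I * (1 - 2 * I * v) *
      (1 / ((t : ℂ) - (2 * v + σ * I)) - 1 / ((t : ℂ) - (-2 * v + (σ - 1) * I))) := by
  have e1 : 2 * I * v - (σ + t * I) = -I * ((t : ℂ) - (2 * v + σ * I)) := by
    linear_combination (-(σ : ℂ)) * I_sq
  have e2 : 2 * I * v - 1 + (σ + t * I) = I * ((t : ℂ) - (-2 * v + (σ - 1) * I)) := by
    linear_combination ((σ : ℂ) - 1) * I_sq
  have e3 : -I * ((t : ℂ) - (2 * v + σ * I)) ≠ 0 := mul_ne_zero (neg_ne_zero.mpr I_ne_zero) h1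
  have e4 : I * ((t : ℂ) - (-2 * v + (σ - 1) * I)) ≠ 0 := mul_ne_zero I_ne_zero h2
  rw [← e1] at e3
  rw [← e2] at e4
  have e5 : 1 / ((t : ℂ) - (2 * v + σ * I)) = -I / (2 * I * v - (σ + t * I)) := by
    rw [e1]
    field_simp
  have e6 : 1 / ((t : ℂ) - (-2 * v + (σ - 1) * I)) = I / (2 * I * v - 1 + (σ + t * I)) := by
    rw [e2]
    field_simp
  rw [e5, e6, transferM]
  field_simp
  linear_combination
    (-8 * I ^ 2 * (v : ℂ) ^ 2 + 6 * I * v - 1) * I_sq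

theorem isBigO_transferM (σ v : ℝ) :
    (fun t : ℝ ↦ transferM (σ + t * I) v - 2
        - ∑ k ∈ Finset.range 7, transferMCoeff σ v k / (t : ℂ) ^ (k + 1))
      =O[atTop] (fun t : ℝ ↦ 1 / t ^ 8) := by
  have h := ((isBigO_one_div_sub_geom (2 * v + σ * I) 7).sub
    (isBigO_one_div_sub_geom (-2 * v + (σ - 1) * I) 7)).const_mul_left (I * (1 - 2 * I * v))
  refine h.congr' ?_ EventuallyEq.rfl
  have hne : ∀ τ : ℂ, ∀ᶠ t : ℝ in atTop, (t : ℂ) - τ ≠ 0 := by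
    intro τ
    filter_upwards [eventually_gt_atTop τ.re] with t ht h0
    have := congrArg re h0
    simp only [sub_re, ofReal_re, zero_re] at this
    linarith
  filter_upwards [hne (2 * v + σ * I), hne (-2 * v + (σ - 1) * I)] with t h1 h2
  rw [transferM_eq σ v t h1 h2]
  simp only [transferMCoeff, mul_div_assoc, ← Finset.mul_sum, sub_div, Finset.sum_sub_distrib]
  ring

theorem re_div_ofReal_pow (z : ℂ) (t : ℝ) (n : ℕ) : (z / (t : ℂ) ^ n).re = z.re / t ^ n := by
  rw [← ofReal_pow, div_ofReal_re]

theorem im_div_ofReal_pow (z : ℂ) (t : ℝ) (n : ℕ) : (z / (t : ℂ) ^ n).im = z.im / t ^ n := by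
  rw [← ofReal_pow, div_ofReal_im]

/-- Under v ↦ -v each pole τ in t becomes -conj τ, so the coefficient of t^(-(k+1)) becomes
(-1)^(k+1) times its conjugate. Hence odd powers of 1/t drop out of both kernels. -/
theorem isBigO_T1 (σ v : ℝ) :
    (fun t : ℝ => T1 (σ + t * Complex.I) v
          - (T1coeff2 σ v / t ^ 2 + T1coeff4 σ v / t ^ 4 + T1coeff6 σ v / t ^ 6))
        =O[atTop] (fun t : ℝ => 1 / t ^ 8) := by
  refine (isBigO_im ((isBigO_transferM σ (-v)).sub (isBigO_transferM σ v))).congr_left fun t ↦ ?_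
  simp only [Finset.sum_range_succ, Finset.sum_range_zero, zero_add, sub_im, add_im,
    im_div_ofReal_pow, T1, T1coeff2, T1coeff4, T1coeff6]
  simp only [transferMCoeff, pow_succ, pow_zero, one_mul, mul_re, mul_im, add_re, add_im, sub_re,
    sub_im, neg_re, neg_im, ofReal_re, ofReal_im, I_re, I_im, one_re, one_im, re_ofNat, im_ofNat,
    ofReal_neg]
  ring

theorem isBigO_T2 (σ v : ℝ) :
    (fun t : ℝ => T2 (σ + t * Complex.I) v
          - (T2coeff2 σ v / t ^ 2 + T2coeff4 σ v / t ^ 4 + T2coeff6 σ v / t ^ 6))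
        =O[atTop] (fun t : ℝ => 1 / t ^ 8) := by
  refine (isBigO_re ((isBigO_transferM σ v).add (isBigO_transferM σ (-v)))).neg_left.congr_left
    fun t ↦ ?_
  simp only [Finset.sum_range_succ, Finset.sum_range_zero, zero_add, sub_re, add_re,
    re_div_ofReal_pow, T2, T2coeff2, T2coeff4, T2coeff6]
  simp only [transferMCoeff, pow_succ, pow_zero, one_mul, mul_re, mul_im, add_re, add_im, sub_re,
    sub_im, neg_re, neg_im, ofReal_re, ofReal_im, I_re, I_im, one_re, one_im, re_ofNat, im_ofNat,
    ofReal_neg]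
  ring

end Expansion

/-! ### Moment relations for Υ on the imaginary axis. -/

section Moments

open Complex ComplexConjugate

/-- The polynomial multiple `(2s - 1) (s (s - 1))ᵏ · s (s - 1) Λ(s)`, which is odd under
`s ↦ 1 - s`. -/
noncomputable def oddXi (k : ℕ) (s : ℂ) : ℂ := (2 * s - 1) * (s * (s - 1)) ^ k * entireXi s

/-- The real part of `oddXi k` on the imaginary axis. -/
noncomputable def xiMoment (k : ℕ) (v : ℝ) : ℝ := (oddXi k (2 * I * v)).re

theorem exists_norm_oddXi_le (k : ℕ) :
    ∃ C, ∀ s : ℂ, 0 ≤ s.re → s.re ≤ 1 → ‖oddXi k s‖ ≤ C * Real.exp (-(1 / 8) * |s.im|) := by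
  obtain ⟨A, hA, hA'⟩ := exists_norm_entireXi_le
  obtain ⟨B, hB, hB'⟩ := exists_add_pow_le_exp (1 + 2 * k) (a := 1 / 8) (by norm_num)
  refine ⟨2 * B * A, fun s h0 h1 ↦ ?_⟩
  have hlin : ‖2 * s - 1‖ ≤ 2 * (3 + |s.im|) := by
    have h2 := norm_le_abs_re_add_abs_im (2 * s - 1)
    have h3 : |(2 * s - 1).re| ≤ 1 := by
      rw [abs_le]
      constructor <;> simp <;> linarith
    have h4 : |(2 * s - 1).im| = 2 * |s.im| := by
      simp [abs_mul]
    linarith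
  have hpow : ‖(s * (s - 1)) ^ k‖ ≤ ((3 + |s.im|) ^ 2) ^ k := by
    rw [norm_pow]
    gcongr
    exact norm_mul_sub_one_le (by linarith) (by linarith)
  rw [oddXi, norm_mul, norm_mul]
  calc _ ≤ 2 * (3 + |s.im|) * ((3 + |s.im|) ^ 2) ^ k * (A * Real.exp (-(1 / 4) * |s.im|)) := by
        gcongr
        exact hA' s (by linarith) (by linarith)
    _ = 2 * (3 + |s.im|) ^ (1 + 2 * k) * (A * Real.exp (-(1 / 4) * |s.im|)) := by
        rw [pow_add, pow_mul]
        ring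
    _ ≤ 2 * (B * Real.exp (1 / 8 * |s.im|)) * (A * Real.exp (-(1 / 4) * |s.im|)) := by
        gcongr
        exact hB' _ (abs_nonneg _)
    _ = 2 * B * A * (Real.exp (1 / 8 * |s.im|) * Real.exp (-(1 / 4) * |s.im|)) := by ring
    _ = _ := by
        rw [← Real.exp_add]
        ring_nf

theorem integralVanishes_xiMoment (k : ℕ) : IntegralVanishes (xiMoment k) := by
  obtain ⟨C, hC⟩ := exists_norm_oddXi_le k
  refine integralVanishes_re_of_odd (g := oddXi k) (C := C) (a := 1 / 8) ?_ (by norm_num) hC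
    (fun s ↦ ?_) fun s ↦ ?_
  · have := differentiable_entireXi
    unfold oddXi
    fun_prop
  · rw [oddXi, oddXi, entireXi_one_sub, show (1 - s) * (1 - s - 1) = s * (s - 1) by ring]
    ring
  · simp [oddXi, entireXi_conj, map_ofNat]

theorem Upsilon_eq_completedRiemannZeta {v : ℝ} (hv : 0 < v) :
    Upsilon (2 * I * v) = completedRiemannZeta (2 * I * v) := by
  have h0 : (2 * I * v : ℂ) ≠ 0 := by simp [hv.ne']
  -- `Gammaℝ` takes the value 0 exactly at its poles 0, -2, -4, …
  have hG : Gammaℝ (2 * I * v) ≠ 0 := by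
    rw [Ne, Gammaℝ_eq_zero_iff]
    rintro ⟨n, hn⟩
    have := congrArg im hn
    simp at this
    exact hv.ne' this
  rw [Upsilon, riemannZeta_def_of_ne_zero h0, mul_assoc, mul_comm (Gamma _), ← Gammaℝ_def,
    div_mul_cancel₀ _ hG]

/-- The exponent is k + 1 because `entireXi` contributes a further factor s(s-1). -/
theorem xiMoment_eq (k : ℕ) {v : ℝ} (hv : 0 < v) :
    xiMoment k v = ((2 * (2 * I * v) - 1) * ((2 * I * v) * (2 * I * v - 1)) ^ (k + 1)
      * ((UpsilonR v : ℂ) + UpsilonI v * I)).re := by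
  have h0 : (2 * I * v : ℂ) ≠ 0 := by simp [hv.ne']
  have h1 : (2 * I * v : ℂ) ≠ 1 := by
    intro h
    have := congrArg re h
    simp at this
  rw [UpsilonR, UpsilonI, re_add_im, Upsilon_eq_completedRiemannZeta hv, xiMoment, oddXi,
    entireXi_eq h0 h1]
  ring_nf

theorem xiMoment_zero_eq {v : ℝ} (hv : 0 < v) :
    xiMoment 0 v = 12 * v ^ 2 * UpsilonR v + (16 * v ^ 3 - 2 * v) * UpsilonI v := by
  rw [xiMoment_eq 0 hv]
  simp [pow_succ]
  ring

theorem xiMoment_one_eq {v : ℝ} (hv : 0 < v) :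
    xiMoment 1 v = (4 * v ^ 2 - 80 * v ^ 4) * UpsilonR v
      + (32 * v ^ 3 - 64 * v ^ 5) * UpsilonI v := by
  rw [xiMoment_eq 1 hv]
  simp [pow_succ]
  ring

theorem xiMoment_two_eq {v : ℝ} (hv : 0 < v) :
    xiMoment 2 v = (448 * v ^ 6 - 80 * v ^ 4) * UpsilonR v
      + (256 * v ^ 7 - 288 * v ^ 5 + 8 * v ^ 3) * UpsilonI v := by
  rw [xiMoment_eq 2 hv]
  simp [pow_succ]
  ring

theorem integralVanishes_of_eq_xiMoment {f : ℝ → ℝ} (α β γ : ℝ)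
    (h : ∀ v, 0 < v → f v = α * xiMoment 0 v + β * xiMoment 1 v + γ * xiMoment 2 v) :
    IntegralVanishes f := by
  obtain ⟨i0, z0⟩ := integralVanishes_xiMoment 0
  obtain ⟨i1, z1⟩ := integralVanishes_xiMoment 1
  obtain ⟨i2, z2⟩ := integralVanishes_xiMoment 2
  have j0 := i0.const_mul α
  have j1 := i1.const_mul β
  have j2 := i2.const_mul γ
  have j01 : IntegrableOn (fun v ↦ α * xiMoment 0 v + β * xiMoment 1 v) (Ioi 0) := j0.add j1
  have hf : EqOn (fun v ↦ α * xiMoment 0 v + β * xiMoment 1 v + γ * xiMoment 2 v) f (Ioi 0) :=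
    fun v hv ↦ (h v hv).symm
  refine ⟨IntegrableOn.congr_fun (j01.add j2) hf measurableSet_Ioi, ?_⟩
  rw [← setIntegral_congr_fun measurableSet_Ioi hf, integral_add j01 j2,
    integral_add j0 j1, integral_const_mul, integral_const_mul, integral_const_mul, z0, z1, z2]
  simp

end Moments

/-! ### Assembly of the expansions and the vanishing integrals. -/

theorem mainTheorem7 :
    -- the large-`t` expansions that single out the background terms of `T₁` and `T₂`
    (∀ σ v : ℝ,
      (fun t : ℝ => T1 (σ + t * Complex.I) v
          - (T1coeff2 σ v / t ^ 2 + T1coeff4 σ v / t ^ 4 + T1coeff6 σ v / t ^ 6))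
        =O[atTop] (fun t : ℝ => 1 / t ^ 8) ∧
      (fun t : ℝ => T2 (σ + t * Complex.I) v
          - (T2coeff2 σ v / t ^ 2 + T2coeff4 σ v / t ^ 4 + T2coeff6 σ v / t ^ 6))
        =O[atTop] (fun t : ℝ => 1 / t ^ 8)) ∧
    -- their contributions to the integral for `ξ_R` cancel at each order, for every `σ`
    (∀ σ : ℝ,
      IntegralVanishes (xiIntegrand (T1coeff2 σ) (T2coeff2 σ)) ∧
      IntegralVanishes (xiIntegrand (T1coeff4 σ) (T2coeff4 σ)) ∧
      IntegralVanishes (xiIntegrand (T1coeff6 σ) (T2coeff6 σ))) ∧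
    -- the `σ`-independent identities of order `t⁻²`, `t⁻⁴` and `t⁻⁶`
    IntegralVanishes (fun v : ℝ =>
      -12 * v ^ 2 * UpsilonR v + v * (2 - 16 * v ^ 2) * UpsilonI v) ∧
    IntegralVanishes (fun v : ℝ =>
      UpsilonR v * v ^ 4 + v * (96 * v ^ 4 - 40 * v ^ 2 - 1) * UpsilonI v / 120) ∧
    IntegralVanishes (fun v : ℝ =>
      224 * UpsilonR v * v ^ 6
        - (-128 * v ^ 7 + 112 * v ^ 5 + 28 * v ^ 3 / 3 + v / 3) * UpsilonI v) := by
  refine ⟨fun σ v ↦ ⟨isBigO_T1 σ v, isBigO_T2 σ v⟩, fun σ ↦ ⟨?_, ?_, ?_⟩, ?_, ?_, ?_⟩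
  · refine integralVanishes_of_eq_xiMoment (-1) 0 0 fun v hv ↦ ?_
    rw [xiIntegrand, T1coeff2, T2coeff2, xiMoment_zero_eq hv]
    ring
  -- Here and below, the weights follow from matching the Υ_I coefficients from the highest power of
  -- v downwards; the Υ_R coefficients then agree. The parameter σ enters only through σ² - σ.
  · refine integralVanishes_of_eq_xiMoment (3 * (σ ^ 2 - σ) + 1) 1 0 fun v hv ↦ ?_
    rw [xiIntegrand, T1coeff4, T2coeff4, xiMoment_zero_eq hv, xiMoment_one_eq hv]
    ring
  · refine integralVanishes_of_eq_xiMoment (-(5 * (σ ^ 2 - σ) ^ 2 + 5 * (σ ^ 2 - σ) + 1))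
      (-(10 * (σ ^ 2 - σ) + 3)) (-1) fun v hv ↦ ?_
    rw [xiIntegrand, T1coeff6, T2coeff6, xiMoment_zero_eq hv, xiMoment_one_eq hv,
      xiMoment_two_eq hv]
    ring
  · refine integralVanishes_of_eq_xiMoment (-1) 0 0 fun v hv ↦ ?_
    rw [xiMoment_zero_eq hv]
    ring
  · refine integralVanishes_of_eq_xiMoment (1 / 240) (-1 / 80) 0 fun v hv ↦ ?_
    rw [xiMoment_zero_eq hv, xiMoment_one_eq hv]
    ring
  · refine integralVanishes_of_eq_xiMoment (1 / 6) (-1 / 2) (1 / 2) fun v hv ↦ ?_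
    rw [xiMoment_zero_eq hv, xiMoment_one_eq hv, xiMoment_two_eq hv]
    ring
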